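/- Let $\mathcal H$, $\mathcal A$, $\mathcal B$ be finite-dimensional complex Hilbert spaces, and let $\mathcal C=\mathcal A\otimes\mathcal B$ be a subspace of $\mathcal H$ (that is, $\mathcal C\subseteq\mathcal H$ is a subspace unitarily identified with $\mathcal A\otimes\mathcal B$), so that $\mathcal H=(\mathcal A\otimes\mathcal B)\oplus\mathcal C^\perp$. Let $P_{\mathcal C}$ be the orthogonal projection of $\mathcal H$ onto $\mathcal C$ and put $\mathcal P_{\mathcal C}(\rho)=P_{\mathcal C}\,\rho\,P_{\mathcal C}$ for linear operators $\rho\in\mathcal L(\mathcal H)$. For $X\in\mathcal L(\mathcal A)$ and $Y\in\mathcal L(\mathcal B)$ write $X\otimes Y$ also for the operator $(X\otimes Y)\oplus 0_{\mathcal C^\perp}$ on $\mathcal H$. A channel on a finite-dimensional Hilbert space $\mathcal K$ is a completely positive, trace-preserving linear map $\mathcal L(\mathcal K)\to\mathcal L(\mathcal K)$. Let $\mathcal E$ be a channel on $\mathcal H$. Then the following are equivalent: 1. $\mathcal B$ is a correctable subsystem for $\mathcal E$, i.e. there are a channel $\mathcal R$ on $\mathcal H$ and a channel $\mathcal F_{\mathcal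 A}$ on $\mathcal A$ such that $\mathcal R\circ\mathcal E\circ\mathcal P_{\mathcal C}=(\mathcal F_{\mathcal A}\otimes\mathrm{id}_{\mathcal B})\circ\mathcal P_{\mathcal C}$. 2. There is a representation $\pi$ of the operator algebra $\mathfrak A_{\mathcal B}=\{1_{\mathcal A}\otimes Y: Y\in\mathcal L(\mathcal B)\}\subseteq\mathcal L(\mathcal H)$ on $\mathcal H$, i.e. a (not necessarily unital) linear map $\pi:\mathfrak A_{\mathcal B}\to\mathcal L(\mathcal H)$ with $\pi(ab)=\pi(a)\pi(b)$ and $\pi(a^\dagger)=\pi(a)^\dagger$ for all $a,b\in\mathfrak A_{\mathcal B}$, such that $$\mathcal E(\rho)=\pi(\rho)\,\mathcal E(P_{\mathcal C})=\mathcal E(P_{\mathcal C})\,\pi(\rho)\qquad\text{for all }\rho\in\mathfrak A_{\mathcal B}.$$ -/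

import Mathlib

open scoped TensorProduct CStarAlgebra

set_option linter.unusedSectionVars false

namespace SubsystemCode

/-- Finite-dimensional complex inner product spaces are complete, i.e. Hilbert spaces. -/
instance (priority := 100) completeSpace_of_finiteDimensional {H : Type*} [NormedAddCommGroup H]
    [InnerProductSpace ℂ H] [FiniteDimensional ℂ H] : CompleteSpace H :=
  FiniteDimensional.complete ℂ H

/-- A quantum channel (quantum operation) on the finite-dimensional Hilbert space `H`:
a completely positive, trace-preserving linear map on the operators on `H`. -/
structure Channel (H : Type*) [NormedAddCommGroup H] [InnerProductSpace ℂ H]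
    [FiniteDimensional ℂ H] extends (H →L[ℂ] H) →CP (H →L[ℂ] H) where
  /-- The map preserves the trace. -/
  trace_map' (T : H →L[ℂ] H) :
    LinearMap.trace ℂ H (toLinearMap T : H →ₗ[ℂ] H) = LinearMap.trace ℂ H (T : H →ₗ[ℂ] H)

section

variable {H A B : Type*}
  [NormedAddCommGroup H] [InnerProductSpace ℂ H] [FiniteDimensional ℂ H]
  [NormedAddCommGroup A] [InnerProductSpace ℂ A] [FiniteDimensional ℂ A]
  [NormedAddCommGroup B] [InnerProductSpace ℂ B] [FiniteDimensional ℂ B]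

/-- `A ⊗ B` with the Hilbert space tensor product structure, included in `H` through the
identification `u` of `A ⊗ B` with the code space `C`. -/
noncomputable def incl (C : Submodule ℂ H) (u : (A ⊗[ℂ] B) ≃ₗᵢ[ℂ] C) : (A ⊗[ℂ] B) →L[ℂ] H :=
  C.subtypeL ∘L (u.toContinuousLinearEquiv : (A ⊗[ℂ] B) →L[ℂ] C)

/-- The orthogonal projection of `H` onto `C`, followed by the identification of `C` with
`A ⊗ B`; this is the adjoint of `incl C u`. -/
noncomputable def coincl (C : Submodule ℂ H) (u : (A ⊗[ℂ] B) ≃ₗᵢ[ℂ] C) : H →L[ℂ] (A ⊗[ℂ] B) :=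
  (u.symm.toContinuousLinearEquiv : C →L[ℂ] (A ⊗[ℂ] B)) ∘L C.orthogonalProjectionOnto

theorem coincl_incl (C : Submodule ℂ H) (u : (A ⊗[ℂ] B) ≃ₗᵢ[ℂ] C) (x : A ⊗[ℂ] B) :
    coincl C u (incl C u x) = x := by
  simp [coincl, incl]

theorem adjoint_incl (C : Submodule ℂ H) (u : (A ⊗[ℂ] B) ≃ₗᵢ[ℂ] C) :
    ContinuousLinearMap.adjoint (incl C u) = coincl C u := by
  symm
  rw [ContinuousLinearMap.eq_adjoint_iff]
  intro x y
  have h1 : inner ℂ (coincl C u x) y = inner ℂ (C.orthogonalProjectionOnto x) (u y) := by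
    rw [← u.inner_map_map]
    simp [coincl]
  rw [h1]
  simp [incl]

/-- The extension `X ⊕ 0` to `H = C ⊕ Cᗮ` of an operator `X` on `C = A ⊗ B`. -/
noncomputable def extendByZero (C : Submodule ℂ H) (u : (A ⊗[ℂ] B) ≃ₗᵢ[ℂ] C)
    (X : (A ⊗[ℂ] B) →L[ℂ] (A ⊗[ℂ] B)) : H →L[ℂ] H :=
  incl C u ∘L X ∘L coincl C u

/-- The compression to `C = A ⊗ B` of an operator on `H`. -/
noncomputable def compress (C : Submodule ℂ H) (u : (A ⊗[ℂ] B) ≃ₗᵢ[ℂ] C)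
    (T : H →L[ℂ] H) : (A ⊗[ℂ] B) →L[ℂ] (A ⊗[ℂ] B) :=
  coincl C u ∘L T ∘L incl C u

/-- The map `P_C : ρ ↦ P_C ρ P_C` on operators, `P_C` the orthogonal projection onto `C`. -/
noncomputable def compression (C : Submodule ℂ H) (ρ : H →L[ℂ] H) : H →L[ℂ] H :=
  C.starProjection * ρ * C.starProjection

variable (A B) in
/-- The canonical isomorphism `L(A) ⊗ L(B) ≃ L(A ⊗ B)`. -/
noncomputable def tensorOpEquiv :
    ((A →L[ℂ] A) ⊗[ℂ] (B →L[ℂ] B)) ≃ₗ[ℂ] ((A ⊗[ℂ] B) →L[ℂ] (A ⊗[ℂ] B)) :=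
  (TensorProduct.congr LinearMap.toContinuousLinearMap.symm
      LinearMap.toContinuousLinearMap.symm).trans
    ((homTensorHomEquiv ℂ A B A B).trans LinearMap.toContinuousLinearMap)

theorem tensorOpEquiv_tmul (X : A →L[ℂ] A) (Y : B →L[ℂ] B) :
    tensorOpEquiv A B (X ⊗ₜ[ℂ] Y) = TensorProduct.mapL X Y := by
  ext z
  simp [tensorOpEquiv]

variable (B) in
/-- The map `F ⊗ id_B` on `L(A ⊗ B) = L(A) ⊗ L(B)`. -/
noncomputable def tensorId (F : (A →L[ℂ] A) →ₗ[ℂ] (A →L[ℂ] A)) :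
    ((A ⊗[ℂ] B) →L[ℂ] (A ⊗[ℂ] B)) →ₗ[ℂ] ((A ⊗[ℂ] B) →L[ℂ] (A ⊗[ℂ] B)) :=
  (tensorOpEquiv A B).conj (F.rTensor (B →L[ℂ] B))

theorem tensorId_mapL (F : (A →L[ℂ] A) →ₗ[ℂ] (A →L[ℂ] A)) (X : A →L[ℂ] A) (Y : B →L[ℂ] B) :
    tensorId B F (TensorProduct.mapL X Y) = TensorProduct.mapL (F X) Y := by
  simp [tensorId, LinearEquiv.conj_apply, ← tensorOpEquiv_tmul]

/-- The subsystem `B` of `C = A ⊗ B ⊆ H` is correctable for the channel `E`: there are a channel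
`R` on `H` and a channel `F` on `A` with `R ∘ E ∘ P_C = (F ⊗ id_B) ∘ P_C` as maps on the
operators on `H`. -/
def IsCorrectable (C : Submodule ℂ H) (u : (A ⊗[ℂ] B) ≃ₗᵢ[ℂ] C) (E : Channel H) : Prop :=
  ∃ (R : Channel H) (F : Channel A), ∀ ρ : H →L[ℂ] H,
    R.toLinearMap (E.toLinearMap (compression C ρ)) =
      extendByZero C u (tensorId B F.toLinearMap (compress C u (compression C ρ)))

/-- The `*`-homomorphism `Y ↦ (1_A ⊗ Y) ⊕ 0` from `L(B)` to `L(H)`. -/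
noncomputable def subsystemHom (C : Submodule ℂ H) (u : (A ⊗[ℂ] B) ≃ₗᵢ[ℂ] C) :
    (B →L[ℂ] B) →⋆ₙₐ[ℂ] (H →L[ℂ] H) where
  toFun Y := extendByZero C u (TensorProduct.mapL (1 : A →L[ℂ] A) Y)
  map_smul' c Y := by
    ext x
    simp [extendByZero, TensorProduct.mapL_smul_right]
  map_zero' := by
    ext x
    simp [extendByZero]
  map_add' Y Z := by
    ext x
    simp [extendByZero, TensorProduct.mapL_add_right]
  map_mul' Y Z := by
    ext x
    have h := TensorProduct.mapL_mul (1 : A →L[ℂ] A) 1 Y Z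
    rw [one_mul] at h
    simp only [extendByZero, h]
    simp only [ContinuousLinearMap.mul_def, ContinuousLinearMap.comp_apply,
      coincl_incl]
  map_star' Y := by
    simp only [extendByZero, ContinuousLinearMap.star_eq_adjoint,
      ContinuousLinearMap.adjoint_comp, TensorProduct.adjoint_mapL, ← adjoint_incl,
      ContinuousLinearMap.adjoint_adjoint]
    rw [← ContinuousLinearMap.star_eq_adjoint (1 : A →L[ℂ] A), star_one,
      ContinuousLinearMap.comp_assoc]

/-- The operator algebra `1_A ⊗ L(B)`, a `*`-subalgebra of `L(H)` whose elements are the operators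
`(1_A ⊗ Y) ⊕ 0` on `H = C ⊕ Cᗮ`. -/
noncomputable def subsystemAlgebra (C : Submodule ℂ H) (u : (A ⊗[ℂ] B) ≃ₗᵢ[ℂ] C) :
    NonUnitalStarSubalgebra ℂ (H →L[ℂ] H) :=
  NonUnitalStarAlgHom.range (subsystemHom C u)

end

end SubsystemCode

/-! Write φ(Y) = (1 ⊗ Y) ⊕ 0 and Q = E(P_C). A positivity argument drives both directions: if S
annihilates the output of a Kraus map on a positive ρ, then S K ρ = 0 for every Kraus operator K
(`mul_kraus_mul_eq_zero`). Applied to a projection p and to 1 - p, then extended linearly, it turns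
identities between maps into intertwining relations for single Kraus operators.

From a recovery with Kraus operators K this gives K E(φ Z) = φ(Z) K Q. The dual map m(T) = ∑ K† T K
then satisfies m(φ Z) Q = E(φ Z), and cutting m down to the range of Q makes it a representation
(`exists_representation_of_recovery`).

Conversely, a representation ψ gives ψ(Z) L φ(1) = L φ(Z) for the Kraus operators L of E. Hence
tr(E(X ⊗ Y) ψ(Z)) = tr X · tr(Z Y), so E(X ⊗ Y) determines tr X · Y. The trace dual of ψ, completed
to a channel, recovers this operator next to a fixed pure state of A
(`isCorrectable_of_representation`). -/

namespace SubsystemCode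

open InnerProductSpace

/-! ### Traces, rank-one operators and projections -/

section Operators

variable {H : Type*} [NormedAddCommGroup H] [InnerProductSpace ℂ H] [FiniteDimensional ℂ H]

/-- The trace of a bounded operator on a finite-dimensional Hilbert space. -/
noncomputable def opTrace (H : Type*) [NormedAddCommGroup H] [InnerProductSpace ℂ H] :
    (H →L[ℂ] H) →ₗ[ℂ] ℂ :=
  LinearMap.trace ℂ H ∘ₗ ContinuousLinearMap.coeLM ℂ

theorem opTrace_mul_comm (S T : H →L[ℂ] H) : opTrace H (S * T) = opTrace H (T * S) :=
  LinearMap.trace_mul_comm ℂ (S : H →ₗ[ℂ] H) (T : H →ₗ[ℂ] H)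

theorem opTrace_rankOne (x y : H) : opTrace H (rankOne ℂ x y) = inner ℂ y x :=
  trace_rankOne x y

theorem opTrace_eq_sum_inner {ι : Type*} [Fintype ι] (b : OrthonormalBasis ι ℂ H)
    (T : H →L[ℂ] H) : opTrace H T = ∑ i, inner ℂ (b i) (T (b i)) :=
  LinearMap.trace_eq_sum_inner _ b

theorem mul_rankOne (T : H →L[ℂ] H) (x y : H) : T * rankOne ℂ x y = rankOne ℂ (T x) y :=
  comp_rankOne ..

theorem rankOne_mul (T : H →L[ℂ] H) (x y : H) : rankOne ℂ x y * T = rankOne ℂ x (star T y) :=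
  rankOne_comp ..

theorem rankOne_mul_rankOne (x y z w : H) :
    rankOne ℂ x y * rankOne ℂ z w = inner ℂ y z • rankOne ℂ x w :=
  rankOne_comp_rankOne ..

theorem rankOne_mul_mul_rankOne (x y z w : H) (T : H →L[ℂ] H) :
    rankOne ℂ x y * T * rankOne ℂ z w = inner ℂ y (T z) • rankOne ℂ x w := by
  rw [mul_assoc, mul_rankOne, rankOne_mul_rankOne]

theorem star_rankOne (x y : H) : star (rankOne ℂ x y) = rankOne ℂ y x :=
  adjoint_rankOne ..

theorem eq_sum_inner_smul_rankOne {ι : Type*} [Fintype ι] (b : OrthonormalBasis ι ℂ H)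
    (T : H →L[ℂ] H) : T = ∑ i, ∑ j, inner ℂ (b i) (T (b j)) • rankOne ℂ (b i) (b j) := by
  have h : ∑ i, rankOne ℂ (b i) (b i) = (1 : H →L[ℂ] H) := OrthonormalBasis.sum_rankOne_eq_id b
  calc T = (∑ i, rankOne ℂ (b i) (b i)) * (T * ∑ i, rankOne ℂ (b i) (b i)) := by simp [h]
    _ = _ := by
      simp only [Finset.sum_mul, Finset.mul_sum, mul_rankOne, rankOne_apply]
      rw [Finset.sum_comm]
      simp

theorem eq_of_forall_opTrace_mul_eq {S T : H →L[ℂ] H}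
    (h : ∀ ρ, opTrace H (ρ * S) = opTrace H (ρ * T)) : S = T := by
  ext x
  refine ext_inner_left ℂ fun y => ?_
  have := h (rankOne ℂ x y)
  rw [opTrace_mul_comm, opTrace_mul_comm _ T] at this
  simpa [mul_rankOne, opTrace_rankOne] using this

/-- A linear map on operators is determined by its values on orthogonal projections. -/
theorem linearMap_eq_of_forall_isStarProjection {V : Type*} [AddCommGroup V] [Module ℂ V]
    {f g : (H →L[ℂ] H) →ₗ[ℂ] V} (h : ∀ p, IsStarProjection p → f p = g p) : f = g := by
  have hdiag (x : H) : f (rankOne ℂ x x) = g (rankOne ℂ x x) := by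
    rcases eq_or_ne x 0 with rfl | hx
    · simp
    have hn : ‖(((‖x‖ : ℂ))⁻¹) • x‖ = 1 := by
      simp [norm_smul, hx]
    have := h _ (isStarProjection_rankOne_self (𝕜 := ℂ) hn)
    have hx' : (‖x‖ : ℂ) ≠ 0 := by simpa using hx
    simpa [hx'] using this
  have hoff (x y : H) : f (rankOne ℂ x y) = g (rankOne ℂ x y) := by
    -- Polarization reduces off-diagonal rank-one operators to multiples of projections.
    have key : rankOne ℂ x y = (4 : ℂ)⁻¹ • (rankOne ℂ (x + y) (x + y)
        - rankOne ℂ (x - y) (x - y)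
        + Complex.I • rankOne ℂ (x + Complex.I • y) (x + Complex.I • y)
        - Complex.I • rankOne ℂ (x - Complex.I • y) (x - Complex.I • y)) := by
      simp only [map_add, map_sub, map_smul, map_smulₛₗ, add_apply,
        sub_apply, smul_apply, Complex.conj_I]
      match_scalars <;> ring_nf <;> simp <;> norm_num
    rw [key]
    simp only [map_add f, map_add g, map_sub f, map_sub g, map_smul f, map_smul g, hdiag]
  ext T
  rw [eq_sum_inner_smul_rankOne (stdOrthonormalBasis ℂ H) T]
  simp [hoff]

end Operators

/-! ### Kraus maps and Choi's theorem -/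

section Kraus

variable {H : Type*} [NormedAddCommGroup H] [InnerProductSpace ℂ H] [FiniteDimensional ℂ H]
  {ι : Type*} [Fintype ι]

/-- The map `ρ ↦ ∑ i, K i * ρ * (K i)†` with Kraus operators `K i`. -/
noncomputable def krausMap (K : ι → H →L[ℂ] H) : (H →L[ℂ] H) →ₗ[ℂ] (H →L[ℂ] H) :=
  ∑ i, LinearMap.mulLeftRight ℂ (K i, star (K i))

theorem krausMap_apply (K : ι → H →L[ℂ] H) (ρ : H →L[ℂ] H) :
    krausMap K ρ = ∑ i, K i * ρ * star (K i) := by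
  simp [krausMap]

theorem krausMap_nonneg (K : ι → H →L[ℂ] H) {ρ : H →L[ℂ] H} (hρ : 0 ≤ ρ) :
    0 ≤ krausMap K ρ := by
  rw [krausMap_apply]
  exact Finset.sum_nonneg fun i _ => star_right_conjugate_nonneg hρ _

theorem exists_eq_star_mul_self {𝔄 : Type*} [NonUnitalCStarAlgebra 𝔄] [PartialOrder 𝔄]
    [StarOrderedRing 𝔄] {a : 𝔄} (ha : 0 ≤ a) : ∃ b, a = star b * b :=
  CStarAlgebra.nonneg_iff_eq_star_mul_self.mp ha

/-- Factor M = N†N; the conjugated matrix is N'†N', where N' has entries N i j * S†. -/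
theorem map_mulLeftRight_nonneg (S : H →L[ℂ] H) {k : ℕ}
    {M : CStarMatrix (Fin k) (Fin k) (H →L[ℂ] H)} (hM : 0 ≤ M) :
    0 ≤ M.map (fun ρ => S * ρ * star S) := by
  obtain ⟨N, rfl⟩ := exists_eq_star_mul_self hM
  have : (star N * N).map (fun ρ => S * ρ * star S) =
      star (N.map (· * star S)) * N.map (· * star S) := by
    ext1 i j
    simp [CStarMatrix.mul_apply, CStarMatrix.star_apply, Finset.mul_sum, Finset.sum_mul, mul_assoc]
  rw [this]
  exact star_mul_self_nonneg _

theorem krausMap_map_cstarMatrix_nonneg (K : ι → H →L[ℂ] H) (k : ℕ)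
    (M : CStarMatrix (Fin k) (Fin k) (H →L[ℂ] H)) (hM : 0 ≤ M) : 0 ≤ M.map (krausMap K) := by
  have : M.map (krausMap K) = ∑ i, M.map (fun ρ => K i * ρ * star (K i)) := by
    ext1 a b
    have (s : Finset ι) : (∑ i ∈ s, M.map (fun ρ => K i * ρ * star (K i))) a b =
        ∑ i ∈ s, K i * M a b * star (K i) := by
      classical
      induction s using Finset.induction_on with
      | empty => simp
      | insert i s hi ih => simp [Finset.sum_insert hi, ih]
    rw [this, CStarMatrix.map_apply, krausMap_apply]
  rw [this]
  exact Finset.sum_nonneg fun i _ => map_mulLeftRight_nonneg _ hM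

/-- The channel with given Kraus operators. -/
noncomputable def krausChannel (K : ι → H →L[ℂ] H)
    (hK : ∀ T, opTrace H (krausMap K T) = opTrace H T) : Channel H where
  toLinearMap := krausMap K
  map_cstarMatrix_nonneg' := krausMap_map_cstarMatrix_nonneg K
  trace_map' := hK

/-- Choi's theorem: every completely positive map has a Kraus representation. -/
theorem exists_krausMap_eq (E : (H →L[ℂ] H) →CP (H →L[ℂ] H)) :
    ∃ K : Fin (Module.finrank ℂ H) × Fin (Module.finrank ℂ H) → H →L[ℂ] H,
      E.toLinearMap = krausMap K := by
  rcases subsingleton_or_nontrivial H with hH | hH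
  · exact ⟨0, LinearMap.ext fun _ => Subsingleton.elim _ _⟩
  set d := Module.finrank ℂ H with hd
  let e : OrthonormalBasis (Fin d) ℂ H := stdOrthonormalBasis ℂ H
  let c₀ : Fin d := ⟨0, Module.finrank_pos⟩
  -- Only row `c₀` of V is nonzero, chosen so that V†V is the matrix of all matrix units; its image
  -- under E is the Choi matrix.
  let V : CStarMatrix (Fin d) (Fin d) (H →L[ℂ] H) :=
    CStarMatrix.ofMatrix fun c i => if c = c₀ then rankOne ℂ (e c) (e i) else 0
  have hVa (c i : Fin d) : V c i = if c = c₀ then rankOne ℂ (e c) (e i) else 0 := rfl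
  have hV (i j : Fin d) : (star V * V) i j = rankOne ℂ (e i) (e j) := by
    rw [CStarMatrix.mul_apply, Finset.sum_eq_single c₀]
    · simp [hVa, CStarMatrix.star_apply, star_rankOne, rankOne_mul_rankOne]
    · intro c _ hc
      simp [hVa, hc]
    · simp
  obtain ⟨N, hN⟩ := exists_eq_star_mul_self
    (E.map_cstarMatrix_nonneg' d _ (star_mul_self_nonneg V))
  have hE (i j : Fin d) :
      E.toLinearMap (rankOne ℂ (e i) (e j)) = ∑ k, star (N k i) * N k j := by
    have := congr_fun (congr_fun hN i) j
    rw [CStarMatrix.map_apply, hV] at this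
    rw [this, CStarMatrix.mul_apply]
    rfl
  -- The index `q.1` is a row of N; `q.2` comes from inserting 1 = ∑ |e l⟩⟨e l| between the factors
  -- of N†N.
  refine ⟨fun q => ∑ i, rankOne ℂ (star (N q.1 i) (e q.2)) (e i), LinearMap.ext fun ρ => ?_⟩
  have h1 : ∑ l, rankOne ℂ (e l) (e l) = (1 : H →L[ℂ] H) := OrthonormalBasis.sum_rankOne_eq_id e
  have hk (k i j : Fin d) : ∑ l, rankOne ℂ (star (N k i) (e l)) (star (N k j) (e l)) =
      star (N k i) * N k j := by
    simp_rw [← rankOne_mul, ← mul_rankOne, mul_assoc, ← Finset.mul_sum, ← Finset.sum_mul, h1,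
      one_mul]
  conv_lhs => rw [eq_sum_inner_smul_rankOne e ρ]
  simp only [map_sum, map_smul, hE, krausMap_apply, star_sum, star_rankOne, Finset.sum_mul,
    Finset.mul_sum, rankOne_mul_mul_rankOne, ← hk, Fintype.sum_prod_type,
    Finset.smul_sum]
  rw [Finset.sum_congr rfl fun i _ => Finset.sum_comm, Finset.sum_comm]
  refine Finset.sum_congr rfl fun k _ => ?_
  rw [Finset.sum_congr rfl fun i _ => Finset.sum_comm, Finset.sum_comm]
  exact Finset.sum_congr rfl fun l _ => Finset.sum_comm

/-- The Kraus operators of a trace-preserving map satisfy `∑ i, (K i)† * K i = 1`. -/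
theorem sum_star_mul_self_eq_one {K : ι → H →L[ℂ] H}
    (hK : ∀ T, opTrace H (krausMap K T) = opTrace H T) : ∑ i, star (K i) * K i = 1 := by
  refine eq_of_forall_opTrace_mul_eq fun ρ => ?_
  rw [mul_one, ← hK ρ, krausMap_apply, Finset.mul_sum, map_sum, map_sum]
  refine Finset.sum_congr rfl fun i _ => ?_
  rw [← mul_assoc, opTrace_mul_comm, mul_assoc]

/-- With ρ = D†D, multiplying the hypothesis by S† exhibits a vanishing sum of the positive
operators (S K D†)(S K D†)†, so each S K D† is zero. -/
theorem mul_kraus_mul_eq_zero {K : ι → H →L[ℂ] H} {S ρ : H →L[ℂ] H} (hρ : 0 ≤ ρ)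
    (h : S * krausMap K ρ = 0) (i : ι) : S * K i * ρ = 0 := by
  obtain ⟨D, rfl⟩ := exists_eq_star_mul_self hρ
  have hsum : ∑ j, (S * K j * star D) * star (S * K j * star D) = 0 := by
    calc _ = S * krausMap K (star D * D) * star S := by
          simp [krausMap_apply, Finset.mul_sum, Finset.sum_mul, mul_assoc]
      _ = 0 := by rw [h, zero_mul]
  have := (Finset.sum_eq_zero_iff_of_nonneg fun j _ => mul_star_self_nonneg _).mp hsum i
    (Finset.mem_univ i)
  rw [← mul_assoc, (CStarRing.mul_star_self_eq_zero_iff _).mp this, zero_mul]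

end Kraus

/-! ### Intertwining relations and the two constructions -/

section Kraus

variable {H B : Type*}
  [NormedAddCommGroup H] [InnerProductSpace ℂ H] [FiniteDimensional ℂ H]
  [NormedAddCommGroup B] [InnerProductSpace ℂ B] [FiniteDimensional ℂ B]
  {ι κ : Type*} [Fintype ι] [Fintype κ]

theorem map_nonneg_of_isStarProjection (φ : (B →L[ℂ] B) →⋆ₙₐ[ℂ] (H →L[ℂ] H)) {p : B →L[ℂ] B}
    (hp : IsStarProjection p) : 0 ≤ φ p := by
  have : φ p = star (φ p) * φ p := by
    rw [← map_star, hp.isSelfAdjoint.star_eq, ← map_mul, hp.isIdempotentElem.eq]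
  rw [this]
  exact star_mul_self_nonneg _

/-- Kraus operators `K` of a recovery intertwine the code algebra on the output of `E`. -/
theorem recovery_kraus_intertwine (φ : (B →L[ℂ] B) →⋆ₙₐ[ℂ] (H →L[ℂ] H))
    (L : ι → H →L[ℂ] H) (K : κ → H →L[ℂ] H)
    (h : ∀ Z Y, φ Z * krausMap K (krausMap L (φ Y)) = krausMap K (krausMap L (φ (Z * Y))))
    (k : κ) (Z : B →L[ℂ] B) :
    K k * krausMap L (φ Z) = φ Z * K k * krausMap L (φ 1) := by
  have key : (LinearMap.mulLeft ℂ (K k) ∘ₗ krausMap L ∘ₗ (φ : (B →L[ℂ] B) →ₗ[ℂ] (H →L[ℂ] H))) =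
      LinearMap.mulRight ℂ (K k * krausMap L (φ 1)) ∘ₗ
        (φ : (B →L[ℂ] B) →ₗ[ℂ] (H →L[ℂ] H)) := by
    refine linearMap_eq_of_forall_isStarProjection fun p hp => ?_
    -- Recovery keeps p inside φ(p) and 1 - p outside it; together the two vanishing products give
    -- the relation at p.
    have h₁ : (1 - φ p) * K k * krausMap L (φ p) = 0 := by
      refine mul_kraus_mul_eq_zero
        (krausMap_nonneg L (map_nonneg_of_isStarProjection φ hp)) ?_ k
      rw [sub_mul, one_mul, h, hp.isIdempotentElem.eq, sub_self]
    have h₂ : φ p * K k * krausMap L (φ (1 - p)) = 0 := by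
      refine mul_kraus_mul_eq_zero
        (krausMap_nonneg L (map_nonneg_of_isStarProjection φ hp.one_sub)) ?_ k
      rw [h, hp.isIdempotentElem.mul_one_sub_self]
      simp
    simp only [map_sub, mul_sub] at h₂
    simp only [sub_mul, one_mul] at h₁
    change K k * krausMap L (φ p) = φ p * (K k * krausMap L (φ 1))
    rw [sub_eq_zero.mp h₁, ← mul_assoc, sub_eq_zero.mp h₂]
  have := LinearMap.congr_fun key Z
  change K k * krausMap L (φ Z) = φ Z * (K k * krausMap L (φ 1)) at this
  rw [this, mul_assoc]

/-- A representation `ψ` describing `E` on the code algebra intertwines the Kraus operators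
of `E`. -/
theorem representation_kraus_intertwine (φ ψ : (B →L[ℂ] B) →⋆ₙₐ[ℂ] (H →L[ℂ] H))
    (L : ι → H →L[ℂ] H) (h : ∀ Y, krausMap L (φ Y) = ψ Y * krausMap L (φ 1))
    (i : ι) (Z : B →L[ℂ] B) : ψ Z * L i * φ 1 = L i * φ Z := by
  have key : LinearMap.mulRight ℂ (L i * φ 1) ∘ₗ (ψ : (B →L[ℂ] B) →ₗ[ℂ] (H →L[ℂ] H)) =
      LinearMap.mulLeft ℂ (L i) ∘ₗ (φ : (B →L[ℂ] B) →ₗ[ℂ] (H →L[ℂ] H)) := by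
    refine linearMap_eq_of_forall_isStarProjection fun p hp => ?_
    have h₁ : (1 - ψ p) * L i * φ p = 0 := by
      refine mul_kraus_mul_eq_zero (map_nonneg_of_isStarProjection φ hp) ?_ i
      rw [h, ← mul_assoc, sub_mul, one_mul, ← map_mul, hp.isIdempotentElem.eq, sub_self, zero_mul]
    have h₂ : ψ p * L i * φ (1 - p) = 0 := by
      refine mul_kraus_mul_eq_zero (map_nonneg_of_isStarProjection φ hp.one_sub) ?_ i
      rw [h, ← mul_assoc, ← map_mul, hp.isIdempotentElem.mul_one_sub_self, map_zero, zero_mul]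
    simp only [map_sub, mul_sub] at h₂
    simp only [sub_mul, one_mul] at h₁
    change ψ p * (L i * φ 1) = L i * φ p
    rw [sub_eq_zero.mp h₁, ← mul_assoc, sub_eq_zero.mp h₂]
  have := LinearMap.congr_fun key Z
  change ψ Z * (L i * φ 1) = L i * φ Z at this
  rw [← this, mul_assoc]

/-- Pulling ψ(Z) through each Kraus operator gives ψ(Z) E(ρ) = E(φ(Z) ρ), and E preserves the trace.
-/
theorem opTrace_krausMap_mul_representation (φ ψ : (B →L[ℂ] B) →⋆ₙₐ[ℂ] (H →L[ℂ] H))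
    {L : ι → H →L[ℂ] H} (hL : ∀ T, opTrace H (krausMap L T) = opTrace H T)
    (h : ∀ Y, krausMap L (φ Y) = ψ Y * krausMap L (φ 1)) {ρ : H →L[ℂ] H} (hρ : φ 1 * ρ = ρ)
    (Z : B →L[ℂ] B) : opTrace H (krausMap L ρ * ψ Z) = opTrace H (φ Z * ρ) := by
  rw [← hL (φ Z * ρ), opTrace_mul_comm]
  congr 1
  simp only [krausMap_apply, Finset.mul_sum]
  refine Finset.sum_congr rfl fun i _ => ?_
  rw [← mul_assoc (L i), ← representation_kraus_intertwine φ ψ L h]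
  simp only [mul_assoc]
  rw [← mul_assoc (φ 1), hρ]

/-- An operator commuting with a self-adjoint `Q` commutes with the projection onto its range. -/
theorem commute_starProjection_range {Q T : H →L[ℂ] H} (hQ : IsSelfAdjoint Q)
    (h : Commute T Q) : Commute T Q.range.starProjection := by
  have hr (x : H) : Q.range.starProjection (T (Q.range.starProjection x)) =
      T (Q.range.starProjection x) := by
    obtain ⟨y, hy⟩ : Q.range.starProjection x ∈ Q.range := Submodule.starProjection_apply_mem _ _
    rw [← hy]
    refine Submodule.starProjection_eq_self_iff.mpr ⟨T y, ?_⟩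
    exact (DFunLike.congr_fun h.eq y).symm
  -- Self-adjointness identifies the complement of the range with the kernel, which T also
  -- preserves.
  have horth (z : H) : z ∈ Q.rangeᗮ ↔ Q z = 0 := by
    rw [ContinuousLinearMap.orthogonal_range, ← ContinuousLinearMap.star_eq_adjoint, hQ.star_eq]
    rfl
  have hk (x : H) : Q.range.starProjection (T (x - Q.range.starProjection x)) = 0 := by
    rw [Submodule.starProjection_apply_eq_zero_iff, horth]
    have hx : Q (x - Q.range.starProjection x) = 0 :=
      (horth _).mp (Submodule.sub_starProjection_mem_orthogonal x)
    have := DFunLike.congr_fun h.eq (x - Q.range.starProjection x)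
    simp only [mul_apply_eq_comp, hx, map_zero] at this
    exact this.symm
  ext x
  have := hk x
  rw [map_sub, map_sub, hr, sub_eq_zero] at this
  exact this.symm

theorem mul_starProjection_range_eq {Q S T : H →L[ℂ] H} (h : S * Q = T * Q) :
    S * Q.range.starProjection = T * Q.range.starProjection := by
  ext x
  obtain ⟨y, hy⟩ : Q.range.starProjection x ∈ Q.range := Submodule.starProjection_apply_mem _ _
  simp only [mul_apply_eq_comp, ← hy]
  exact DFunLike.congr_fun h y

theorem starProjection_range_mul (Q : H →L[ℂ] H) : Q.range.starProjection * Q = Q := by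
  ext x
  exact Submodule.starProjection_eq_self_iff.mpr ⟨x, rfl⟩

/-- A recovery `K` for `E` on the code algebra yields a representation describing `E` there. -/
theorem exists_representation_of_recovery (φ : (B →L[ℂ] B) →⋆ₙₐ[ℂ] (H →L[ℂ] H))
    (L : ι → H →L[ℂ] H) {K : κ → H →L[ℂ] H}
    (hK : ∀ T, opTrace H (krausMap K T) = opTrace H T)
    (h : ∀ Z Y, φ Z * krausMap K (krausMap L (φ Y)) = krausMap K (krausMap L (φ (Z * Y)))) :
    ∃ π : NonUnitalStarAlgHom.range φ →⋆ₙₐ[ℂ] (H →L[ℂ] H),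
      ∀ ρ : NonUnitalStarAlgHom.range φ,
        krausMap L (ρ : H →L[ℂ] H) = π ρ * krausMap L (φ 1) ∧
        krausMap L (ρ : H →L[ℂ] H) = krausMap L (φ 1) * π ρ := by
  set Q := krausMap L (φ 1) with hQdef
  have hQ : IsSelfAdjoint Q := IsSelfAdjoint.of_nonneg
    (krausMap_nonneg L (map_nonneg_of_isStarProjection φ (.one _)))
  let m : (H →L[ℂ] H) →ₗ[ℂ] (H →L[ℂ] H) := krausMap fun k => star (K k)
  have hm (T : H →L[ℂ] H) : m T = ∑ k, star (K k) * T * K k := by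
    simp [m, krausMap_apply]
  have hmstar (T : H →L[ℂ] H) : m (star T) = star (m T) := by
    simp [hm, mul_assoc]
  have hKm (k : κ) (Z : B →L[ℂ] B) := recovery_kraus_intertwine φ L K h k Z
  -- Intertwining moves φ(Z) past each K, leaving ∑ K†K = 1.
  have hmQ (Z : B →L[ℂ] B) : m (φ Z) * Q = krausMap L (φ Z) := by
    simp only [hm, Finset.sum_mul, mul_assoc]
    simp only [← mul_assoc (φ Z), ← hKm, hQdef]
    simp only [← mul_assoc, ← Finset.sum_mul, sum_star_mul_self_eq_one hK, one_mul]
  have hstarL (T : H →L[ℂ] H) : star (krausMap L T) = krausMap L (star T) := by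
    simp [krausMap_apply, mul_assoc]
  have hQm (Z : B →L[ℂ] B) : Q * m (φ Z) = krausMap L (φ Z) := by
    rw [← star_inj, star_mul, hQ.star_eq, ← hmstar, ← map_star, hmQ, hstarL, map_star]
  have hcomm (Z : B →L[ℂ] B) : Commute (m (φ Z)) Q.range.starProjection :=
    commute_starProjection_range hQ ((hmQ Z).trans (hQm Z).symm)
  have hmul (Z W : B →L[ℂ] B) : m (φ Z) * m (φ W) * Q = m (φ (Z * W)) * Q := by
    rw [mul_assoc, hmQ, hm, Finset.sum_mul, hm, Finset.sum_mul]
    refine Finset.sum_congr rfl fun k _ => ?_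
    rw [mul_assoc _ (K k), hKm, map_mul]
    simp only [mul_assoc, hQdef]
  have hproj : IsStarProjection Q.range.starProjection := isStarProjection_starProjection
  have hQproj : Q * Q.range.starProjection = Q := by
    rw [← star_inj, star_mul, hQ.star_eq, hproj.isSelfAdjoint.star_eq, starProjection_range_mul]
  -- By `hmul`, m is known to be multiplicative only after multiplication by Q; the range projection
  -- commutes with each m(φ Z), so this cut-down respects products and adjoints.
  refine ⟨{ toFun := fun ρ => m ρ * Q.range.starProjection
            map_smul' := fun c ρ => by simp
            map_zero' := by simp
            map_add' := fun ρ σ => by simp [add_mul]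
            map_mul' := ?_
            map_star' := ?_ }, ?_⟩
  · rintro ⟨_, Z, rfl⟩ ⟨_, W, rfl⟩
    change m (φ Z * φ W) * _ = m (φ Z) * _ * (m (φ W) * _)
    rw [← map_mul, ← mul_starProjection_range_eq (hmul Z W), (hcomm W).eq, ← mul_assoc,
      mul_assoc (m (φ Z)) Q.range.starProjection Q.range.starProjection, hproj.isIdempotentElem.eq,
      mul_assoc (m (φ Z)) (m (φ W)), mul_assoc (m (φ Z)) _ (m (φ W)), (hcomm W).eq]
  · rintro ⟨_, Z, rfl⟩
    change m (star (φ Z)) * _ = star (m (φ Z) * _)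
    rw [star_mul, hproj.isSelfAdjoint.star_eq, hmstar]
    have := (hcomm (star Z)).eq
    rwa [map_star, hmstar] at this
  · rintro ⟨_, Z, rfl⟩
    change krausMap L (φ Z) = m (φ Z) * _ * Q ∧ krausMap L (φ Z) = Q * (m (φ Z) * _)
    constructor
    · rw [mul_assoc, starProjection_range_mul, hmQ]
    · rw [← mul_assoc, hQm, ← hmQ, mul_assoc, hQproj]

/-- The channel `ρ ↦ T ρ ⊕ tr (ρ (1 - ψ 1))`, where `T` is the trace dual of the representation
`ψ`, realised on the orthonormal family `v`. -/
theorem exists_channel_of_representation (ψ : (B →L[ℂ] B) →⋆ₙₐ[ℂ] (H →L[ℂ] H))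
    (e : OrthonormalBasis ι ℂ B) {v : ι → H} (hv : Orthonormal ℂ v) (i₀ : ι) :
    ∃ R : Channel H, ∀ ρ, R.toLinearMap ρ =
      (∑ i, ∑ j, opTrace H (ρ * ψ (rankOne ℂ (e j) (e i))) • rankOne ℂ (v i) (v j)) +
        opTrace H (ρ * (1 - ψ 1)) • rankOne ℂ (v i₀) (v i₀) := by
  let f := stdOrthonormalBasis ℂ H
  have htr (S T ρ : H →L[ℂ] H) (x y : H) :
      ∑ h, rankOne ℂ x (S (f h)) * ρ * rankOne ℂ (T (f h)) y =
        opTrace H (ρ * (T * star S)) • rankOne ℂ x y := by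
    simp only [rankOne_mul_mul_rankOne]
    rw [← Finset.sum_smul, ← mul_assoc, opTrace_mul_comm, opTrace_eq_sum_inner f]
    simp [ContinuousLinearMap.star_eq_adjoint, ContinuousLinearMap.adjoint_inner_right]
  -- The first family implements the trace dual of ψ; the auxiliary `i₀` cancels in products of
  -- matrix units (`hψ`). The second sends the weight outside ψ(1) to `v i₀`, restoring the trace.
  let K : Fin (Module.finrank ℂ H) ⊕ Fin (Module.finrank ℂ H) → H →L[ℂ] H :=
    Sum.elim (fun h => ∑ i, rankOne ℂ (v i) (ψ (rankOne ℂ (e i) (e i₀)) (f h)))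
      (fun h => rankOne ℂ (v i₀) ((1 - ψ 1) (f h)))
  have hone : (1 - ψ 1) * star (1 - ψ 1) = 1 - ψ 1 := by
    have hψ : ψ 1 * ψ 1 = ψ 1 := by rw [← map_mul, one_mul]
    have hψs : star (ψ 1) = ψ 1 := by rw [← map_star, star_one]
    rw [star_sub, star_one, hψs, mul_sub, sub_mul, sub_mul, hψ]
    simp
  have hψ (i j : ι) : ψ (rankOne ℂ (e j) (e i₀)) * star (ψ (rankOne ℂ (e i) (e i₀))) =
      ψ (rankOne ℂ (e j) (e i)) := by
    rw [← map_star, star_rankOne, ← map_mul, rankOne_mul_rankOne]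
    simp
  have hK (ρ : H →L[ℂ] H) : krausMap K ρ =
      (∑ i, ∑ j, opTrace H (ρ * ψ (rankOne ℂ (e j) (e i))) • rankOne ℂ (v i) (v j)) +
        opTrace H (ρ * (1 - ψ 1)) • rankOne ℂ (v i₀) (v i₀) := by
    rw [krausMap_apply, Fintype.sum_sum_type]
    congr 1
    · simp only [K, Sum.elim_inl, star_sum, star_rankOne, Finset.sum_mul, Finset.mul_sum]
      have hterm (i j : ι) :
          opTrace H (ρ * ψ (rankOne ℂ (e j) (e i))) • rankOne ℂ (v i) (v j) =
            ∑ h, rankOne ℂ (v i) (ψ (rankOne ℂ (e i) (e i₀)) (f h)) * ρ *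
              rankOne ℂ (ψ (rankOne ℂ (e j) (e i₀)) (f h)) (v j) := by
        rw [htr, hψ]
      simp only [hterm]
      rw [Finset.sum_congr rfl fun h _ => Finset.sum_comm, Finset.sum_comm]
      exact Finset.sum_congr rfl fun i _ => Finset.sum_comm
    · simp only [K, Sum.elim_inr, star_rankOne]
      rw [htr, hone]
  refine ⟨krausChannel K fun T => ?_, hK⟩
  have h1 : ∑ i, rankOne ℂ (e i) (e i) = (1 : B →L[ℂ] B) := OrthonormalBasis.sum_rankOne_eq_id e
  classical
  rw [hK, map_add, map_sum]
  simp only [map_sum, map_smul, opTrace_rankOne, orthonormal_iff_ite.mp hv]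
  simp only [smul_eq_mul, mul_ite, mul_one, mul_zero, Finset.sum_ite_eq',
    Finset.mem_univ, if_true]
  rw [← map_sum, ← Finset.mul_sum, ← map_sum, h1, ← map_add, ← mul_add]
  simp

end Kraus

/-! ### The code space and recovery from a representation -/

section Code

variable {H A B : Type*}
  [NormedAddCommGroup H] [InnerProductSpace ℂ H] [FiniteDimensional ℂ H]
  [NormedAddCommGroup A] [InnerProductSpace ℂ A] [FiniteDimensional ℂ A]
  [NormedAddCommGroup B] [InnerProductSpace ℂ B] [FiniteDimensional ℂ B]
  (C : Submodule ℂ H) (u : (A ⊗[ℂ] B) ≃ₗᵢ[ℂ] C)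

theorem incl_comp_coincl : incl C u ∘L coincl C u = C.starProjection := by
  ext x
  simp [incl, coincl]

theorem extendByZero_mul (X Y : (A ⊗[ℂ] B) →L[ℂ] (A ⊗[ℂ] B)) :
    extendByZero C u X * extendByZero C u Y = extendByZero C u (X * Y) := by
  ext x
  change incl C u (X (coincl C u (incl C u (Y (coincl C u x))))) = _
  rw [coincl_incl]
  rfl

theorem compress_extendByZero (X : (A ⊗[ℂ] B) →L[ℂ] (A ⊗[ℂ] B)) :
    compress C u (extendByZero C u X) = X := by
  ext1 x
  change coincl C u (incl C u (X (coincl C u (incl C u x)))) = X x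
  rw [coincl_incl, coincl_incl]

theorem extendByZero_compress (T : H →L[ℂ] H) :
    extendByZero C u (compress C u T) = compression C T := by
  rw [compression, ← incl_comp_coincl C u]
  rfl

theorem subsystemHom_apply (Y : B →L[ℂ] B) :
    subsystemHom C u Y = extendByZero C u (TensorProduct.mapL (1 : A →L[ℂ] A) Y) := rfl

theorem subsystemHom_one : subsystemHom C u 1 = C.starProjection := by
  rw [subsystemHom_apply, ← incl_comp_coincl C u]
  ext x
  simp [extendByZero]

theorem compression_extendByZero (X : (A ⊗[ℂ] B) →L[ℂ] (A ⊗[ℂ] B)) :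
    compression C (extendByZero C u X) = extendByZero C u X := by
  rw [← extendByZero_compress C u, compress_extendByZero]

theorem subsystemHom_mul_extendByZero_mapL (Z Y : B →L[ℂ] B) (X : A →L[ℂ] A) :
    subsystemHom C u Z * extendByZero C u (TensorProduct.mapL X Y) =
      extendByZero C u (TensorProduct.mapL X (Z * Y)) := by
  rw [subsystemHom_apply, extendByZero_mul, ← TensorProduct.mapL_mul, one_mul]

theorem opTrace_extendByZero_mapL (X : A →L[ℂ] A) (Y : B →L[ℂ] B) :
    opTrace H (extendByZero C u (TensorProduct.mapL X Y)) = opTrace A X * opTrace B Y := by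
  have h : opTrace H (extendByZero C u (TensorProduct.mapL X Y)) =
      LinearMap.trace ℂ (A ⊗[ℂ] B)
        (TensorProduct.map (X : A →ₗ[ℂ] A) (Y : B →ₗ[ℂ] B)) := by
    have := LinearMap.trace_comp_comm' (R := ℂ)
      (incl C u : (A ⊗[ℂ] B) →ₗ[ℂ] H)
      ((TensorProduct.mapL X Y ∘L coincl C u : H →L[ℂ] (A ⊗[ℂ] B)) : H →ₗ[ℂ] (A ⊗[ℂ] B))
    refine this.symm.trans (congrArg _ ?_)
    ext1
    ext x y
    simp [coincl_incl]
  rw [h, LinearMap.trace_tensorProduct']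
  rfl

theorem extendByZero_mapL_rankOne (a a' : A) (b b' : B) :
    extendByZero C u (TensorProduct.mapL (rankOne ℂ a a') (rankOne ℂ b b')) =
      rankOne ℂ (incl C u (a ⊗ₜ b)) (incl C u (a' ⊗ₜ b')) := by
  have h : TensorProduct.mapL (rankOne ℂ a a') (rankOne ℂ b b') =
      rankOne ℂ (a ⊗ₜ[ℂ] b) (a' ⊗ₜ[ℂ] b') := by
    apply ContinuousLinearMap.coe_injective
    ext x y
    simp [← TensorProduct.smul_tmul', smul_smul, mul_comm]
  rw [h, extendByZero, ← adjoint_incl]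
  ext x
  simp [ContinuousLinearMap.adjoint_inner_right]

/-- Two linear maps on the operators of `A ⊗ B` agreeing on product operators agree. -/
theorem linearMap_eq_of_forall_mapL {V : Type*} [AddCommGroup V] [Module ℂ V]
    {f g : ((A ⊗[ℂ] B) →L[ℂ] (A ⊗[ℂ] B)) →ₗ[ℂ] V}
    (h : ∀ X Y, f (TensorProduct.mapL X Y) = g (TensorProduct.mapL X Y)) : f = g := by
  have : f ∘ₗ (tensorOpEquiv A B).toLinearMap = g ∘ₗ (tensorOpEquiv A B).toLinearMap := by
    ext X Y
    simpa [tensorOpEquiv_tmul] using h X Y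
  ext1 T
  simpa using LinearMap.congr_fun this ((tensorOpEquiv A B).symm T)

/-- `extendByZero` as a linear map. -/
noncomputable def extendByZeroₗ :
    ((A ⊗[ℂ] B) →L[ℂ] (A ⊗[ℂ] B)) →ₗ[ℂ] (H →L[ℂ] H) where
  toFun := extendByZero C u
  map_add' X Y := by
    ext x
    simp [extendByZero]
  map_smul' c X := by
    ext x
    simp [extendByZero]

theorem extendByZeroₗ_apply (X : (A ⊗[ℂ] B) →L[ℂ] (A ⊗[ℂ] B)) :
    extendByZeroₗ C u X = extendByZero C u X := rfl

/-- The channel replacing every state by the pure state of the unit vector `a`. -/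
theorem exists_replacement_channel {a : A} (ha : ‖a‖ = 1) :
    ∃ F : Channel A, ∀ X, F.toLinearMap X = opTrace A X • rankOne ℂ a a := by
  let f := stdOrthonormalBasis ℂ A
  have hK (X : A →L[ℂ] A) :
      krausMap (fun i => rankOne ℂ a (f i)) X = opTrace A X • rankOne ℂ a a := by
    simp only [krausMap_apply, star_rankOne, rankOne_mul_mul_rankOne]
    rw [← Finset.sum_smul, opTrace_eq_sum_inner f]
  refine ⟨krausChannel _ fun X => ?_, hK⟩
  rw [hK, map_smul, opTrace_rankOne, inner_self_eq_norm_sq_to_K, ha]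
  simp

theorem exists_channel_eq_id (H : Type*) [NormedAddCommGroup H] [InnerProductSpace ℂ H]
    [FiniteDimensional ℂ H] : ∃ F : Channel H, ∀ X, F.toLinearMap X = X := by
  have hK (X : H →L[ℂ] H) : krausMap (fun _ : Unit => (1 : H →L[ℂ] H)) X = X := by
    simp [krausMap_apply]
  exact ⟨krausChannel _ fun X => by rw [hK], hK⟩

/-- Covers the degenerate case, where A may have no unit vector or B no basis index; both sides
vanish for any choice of channels. -/
theorem isCorrectable_of_subsingleton [Subsingleton (A ⊗[ℂ] B)] (E : Channel H) :
    IsCorrectable C u E := by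
  obtain ⟨R, -⟩ := exists_channel_eq_id H
  obtain ⟨F, -⟩ := exists_channel_eq_id A
  have h0 (X : (A ⊗[ℂ] B) →L[ℂ] (A ⊗[ℂ] B)) : extendByZero C u X = 0 := by
    rw [Subsingleton.elim X 0, ← extendByZeroₗ_apply, map_zero]
  refine ⟨R, F, fun ρ => ?_⟩
  rw [h0, ← extendByZero_compress C u, h0, map_zero, map_zero]

/-- The recovered operator has matrix coefficients tr X · ⟨e i, Y e j⟩ on the vectors a ⊗ e i, so F
resets A to the pure state of a. -/
theorem isCorrectable_of_representation [Nontrivial A] [Nontrivial B] {ι : Type*} [Fintype ι]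
    {E : Channel H} {L : ι → H →L[ℂ] H} (hL : E.toLinearMap = krausMap L)
    (ψ : (B →L[ℂ] B) →⋆ₙₐ[ℂ] (H →L[ℂ] H))
    (h : ∀ Y, krausMap L (subsystemHom C u Y) = ψ Y * krausMap L (subsystemHom C u 1)) :
    IsCorrectable C u E := by
  obtain ⟨a, ha⟩ := exists_norm_eq A zero_le_one
  let e := stdOrthonormalBasis ℂ B
  let i₀ : Fin (Module.finrank ℂ B) := ⟨0, Module.finrank_pos⟩
  have hv : Orthonormal ℂ fun i => incl C u (a ⊗ₜ[ℂ] e i) := by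
    classical
    rw [orthonormal_iff_ite]
    intro i j
    rw [← ContinuousLinearMap.adjoint_inner_right, adjoint_incl, coincl_incl,
      TensorProduct.inner_tmul, inner_self_eq_norm_sq_to_K, ha, orthonormal_iff_ite.mp e.orthonormal]
    simp
  obtain ⟨R, hR⟩ := exists_channel_of_representation ψ e hv i₀
  obtain ⟨F, hF⟩ := exists_replacement_channel ha
  have hLtr (T : H →L[ℂ] H) : opTrace H (krausMap L T) = opTrace H T := by
    rw [← hL]
    exact E.trace_map' T
  have hφ1 (X : A →L[ℂ] A) (Y : B →L[ℂ] B) :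
      subsystemHom C u 1 * extendByZero C u (TensorProduct.mapL X Y) =
        extendByZero C u (TensorProduct.mapL X Y) := by
    rw [subsystemHom_mul_extendByZero_mapL, one_mul]
  have htr (X : A →L[ℂ] A) (Y Z : B →L[ℂ] B) :
      opTrace H (krausMap L (extendByZero C u (TensorProduct.mapL X Y)) * ψ Z) =
        opTrace A X * opTrace B (Z * Y) := by
    rw [opTrace_krausMap_mul_representation (subsystemHom C u) ψ hLtr h (hφ1 X Y),
      subsystemHom_mul_extendByZero_mapL, opTrace_extendByZero_mapL]
  have key : R.toLinearMap ∘ₗ E.toLinearMap ∘ₗ extendByZeroₗ C u =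
      extendByZeroₗ C u ∘ₗ tensorId B F.toLinearMap := by
    refine linearMap_eq_of_forall_mapL fun X Y => ?_
    simp only [LinearMap.comp_apply, tensorId_mapL, hF, extendByZeroₗ_apply, hR, hL]
    -- Outputs of the code carry no trace outside ψ(1), so the completing term of R drops out.
    have hrest : opTrace H (krausMap L (extendByZero C u (TensorProduct.mapL X Y)) *
        (1 - ψ 1)) = 0 := by
      rw [mul_sub, map_sub, htr, mul_one, hLtr, opTrace_extendByZero_mapL, one_mul, sub_self]
    rw [hrest, zero_smul, add_zero]
    simp only [htr, rankOne_mul, opTrace_rankOne]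
    conv_rhs => rw [eq_sum_inner_smul_rankOne e Y]
    have hmap : extendByZero C u (TensorProduct.mapL (opTrace A X • rankOne ℂ a a)
        (∑ i, ∑ j, inner ℂ (e i) (Y (e j)) • rankOne ℂ (e i) (e j))) =
        ∑ i, ∑ j, (opTrace A X * inner ℂ (e i) (Y (e j))) •
          extendByZero C u (TensorProduct.mapL (rankOne ℂ a a) (rankOne ℂ (e i) (e j))) := by
      simp only [← extendByZeroₗ_apply, ← tensorOpEquiv_tmul, TensorProduct.tmul_sum,
        TensorProduct.tmul_smul, ← TensorProduct.smul_tmul', map_sum, map_smul, smul_smul]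
      simp only [mul_comm]
    rw [hmap]
    simp [extendByZero_mapL_rankOne, ContinuousLinearMap.star_eq_adjoint,
      ContinuousLinearMap.adjoint_inner_left]
  refine ⟨R, F, fun ρ => ?_⟩
  have := LinearMap.congr_fun key (compress C u ρ)
  simp only [LinearMap.comp_apply, extendByZeroₗ_apply] at this
  rw [extendByZero_compress] at this
  rw [this, ← extendByZero_compress C u ρ, compress_extendByZero]

end Code

end SubsystemCode

/-! ### The equivalence -/

theorem theorem2p3 {H A B : Type*}
    [NormedAddCommGroup H] [InnerProductSpace ℂ H] [FiniteDimensional ℂ H]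
    [NormedAddCommGroup A] [InnerProductSpace ℂ A] [FiniteDimensional ℂ A]
    [NormedAddCommGroup B] [InnerProductSpace ℂ B] [FiniteDimensional ℂ B]
    (C : Submodule ℂ H) (u : (A ⊗[ℂ] B) ≃ₗᵢ[ℂ] C) (E : SubsystemCode.Channel H) :
    SubsystemCode.IsCorrectable C u E ↔
      ∃ π : SubsystemCode.subsystemAlgebra C u →⋆ₙₐ[ℂ] (H →L[ℂ] H),
        ∀ ρ : SubsystemCode.subsystemAlgebra C u,
          E.toLinearMap (ρ : H →L[ℂ] H) = π ρ * E.toLinearMap C.starProjection ∧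
          E.toLinearMap (ρ : H →L[ℂ] H) = E.toLinearMap C.starProjection * π ρ := by
  obtain ⟨L, hL⟩ := SubsystemCode.exists_krausMap_eq E.toCompletelyPositiveMap
  rw [← SubsystemCode.subsystemHom_one C u]
  constructor
  · rintro ⟨R, F, h⟩
    obtain ⟨K, hK⟩ := SubsystemCode.exists_krausMap_eq R.toCompletelyPositiveMap
    -- The recovered operator is F(1) ⊗ Y, so left multiplication by φ(Z) only changes Y to Z Y.
    have hφ (Y : B →L[ℂ] B) :
        R.toLinearMap (E.toLinearMap (SubsystemCode.subsystemHom C u Y)) =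
          SubsystemCode.extendByZero C u (TensorProduct.mapL (F.toLinearMap 1) Y) := by
      have := h (SubsystemCode.subsystemHom C u Y)
      rwa [SubsystemCode.subsystemHom_apply, SubsystemCode.compression_extendByZero,
        SubsystemCode.compress_extendByZero, SubsystemCode.tensorId_mapL] at this
    rw [hL]
    refine SubsystemCode.exists_representation_of_recovery (SubsystemCode.subsystemHom C u) L
      (K := K) (fun T => ?_) fun Z Y => ?_
    · rw [← hK]
      exact R.trace_map' T
    · rw [← hK, ← hL, hφ, hφ, SubsystemCode.subsystemHom_mul_extendByZero_mapL]
  · rintro ⟨π, h⟩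
    rcases subsingleton_or_nontrivial A with hA | hA
    · have : Subsingleton (A ⊗[ℂ] B) := inferInstance
      exact SubsystemCode.isCorrectable_of_subsingleton C u E
    rcases subsingleton_or_nontrivial B with hB | hB
    · have : Subsingleton (A ⊗[ℂ] B) := inferInstance
      exact SubsystemCode.isCorrectable_of_subsingleton C u E
    refine SubsystemCode.isCorrectable_of_representation C u hL
      (π.comp (NonUnitalStarAlgHom.codRestrict (SubsystemCode.subsystemHom C u)
        (SubsystemCode.subsystemAlgebra C u) fun Y => ⟨Y, rfl⟩)) fun Y => ?_
    rw [← hL]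
    -- One identity suffices; the other follows from it by taking adjoints.
    exact (h ⟨SubsystemCode.subsystemHom C u Y, Y, rfl⟩).1
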